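/- Let $\mathcal H$ be a real Hilbert space, $m\ge 2$, and $\sigma_1,\dots,\sigma_m\in\mathbb R$. For $i=1,\dots,m$ let $A_i:\mathcal H\rightrightarrows\mathcal H$ be maximal $\sigma_i$-comonotone, i.e. for every $(x,u)\in\mathcal H\times\mathcal H$ one has $u\in A_i(x)$ if and only if $\langle x-y,u-v\rangle\ge\sigma_i\|u-v\|^2$ for all $y\in\mathcal H$, $v\in A_i(y)$. Assume that $A_1+\cdots+A_m$ has a zero. ($\operatorname{zer}(A)=\{x:0\in A(x)\}$, $\operatorname{Fix}(T)=\{x:x\in T(x)\}$.) On the Hilbert space $\mathcal H^{m-1}$, with diagonal $\mathbf D=\{(x_1,\dots,x_{m-1}):x_1=\cdots=x_{m-1}\}$ and normal cone operator $N_{\mathbf D}$, define $$\mathbf F(\mathbf x)=A_1(x_1)\times\cdots\times A_{m-1}(x_{m-1}),\qquad \mathbf G(\mathbf x)=\mathbf K(\mathbf x)+N_{\mathbf D}(\mathbf x),$$ where $\mathbf K(\mathbf x)=\{\tfrac1{m-1}(v,\dots,v):v\in A_m(x_1)\}$ for $\mathbf x\in\mathbf D$ and $\mathbf K(\mathbf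 x)=\emptyset$ otherwise. For an operator $A$ and $\gamma>0$ put $J_{\gamma A}=(\mathrm{Id}+\gamma A)^{-1}$, $J^{\lambda}_{\gamma A}=\lambda J_{\gamma A}+(1-\lambda)\mathrm{Id}$ and ${}^{\gamma}\!A=\frac1\gamma(\mathrm{Id}-J_{\gamma A})$. Let $\gamma,\delta,\lambda,\mu>0$ satisfy $(\lambda-1)(\mu-1)=1$ and $\delta=\gamma(\lambda-1)$, let $\kappa>0$, and put $T_{\mathbf F,\mathbf G}=(1-\kappa)\mathrm{Id}+\kappa J^{\mu}_{\delta\mathbf G}J^{\lambda}_{\gamma\mathbf F}$. Let $\underline\sigma=\min_{1\le i\le m-1}\sigma_i$, and let $\Theta$ be the set of $\theta\in(0,\infty)^{m-1}$ with $\sum_{i=1}^{m-1}1/\theta_i=1$ and $\sigma_i+\sigma_m\theta_i>0$ for all $i\le m-1$. For $\theta\in\Theta$ put $$\kappa_i^*=\frac{4(\gamma+\sigma_i)(\delta+\sigma_m\theta_i)-(\gamma+\delta)^2}{2(\gamma+\delta)(\sigma_i+\sigma_m\theta_i)},\qquad i=1,\dots,m-1.$$ Consider the conditions: * (C1) $\underline\sigma=-(m-1)\sigma_m\ge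 0$ and $\delta=\gamma+2\underline\sigma$; * (C2) $\underline\sigma>-(m-1)\sigma_m\ge 0$ and $(\gamma+\delta)^2<4(\gamma+\underline\sigma)(\delta+(m-1)\sigma_m)$; * (C3) $\sigma_i>0$ for $i\le m-1$, $\sigma_m<0$, $\sum_{i=1}^m 1/\sigma_i<0$, $\kappa\in(0,1)$, and for some $\theta\in\Theta$ either (a) $\min_{i\le m-1}\kappa_i^*\ge 1$, or (b) $\gamma=\delta$, $\lambda=\mu=2$ and $\min_{i\le m-1}\kappa_i^*>\kappa$. Assume that one of the following holds: (C1) with $\kappa<1$; (C2) with $$\kappa<\frac{4(\gamma+\underline\sigma)(\delta+(m-1)\sigma_m)-(\gamma+\delta)^2}{2(\gamma+\delta)(\underline\sigma+(m-1)\sigma_m)};$$ or (C3). Let $(\mathbf x^k,\mathbf y^k,\mathbf z^k)_{k\ge0}$ in $\mathcal H^{m-1}$ satisfy, for an arbitrary $\mathbf x^0$ and all $k$, $$\mathbf y^k\in J_{\gamma\mathbf F}(\mathbf x^k),\qquad \mathbf z^k\in J_{\delta\mathbf G}((1-\lambda)\mathbf x^k+\lambda\mathbf y^k),\qquad \mathbf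 x^{k+1}=\mathbf x^k+\kappa\mu(\mathbf z^k-\mathbf y^k).$$ Then: 1. There is $\bar{\mathbf x}\in\operatorname{Fix}(T_{\mathbf F,\mathbf G})$ such that $J_{\gamma\mathbf F}(\bar{\mathbf x})$ is a single point, belongs to $\operatorname{zer}(\mathbf F+\mathbf G)$, and $\mathbf x^k\rightharpoonup\bar{\mathbf x}$ weakly. 2. $\|\mathbf x^k-\mathbf x^{k+1}\|=o(1/\sqrt k)$ and $\|\mathbf y^k-\mathbf y^{k+1}\|=o(1/\sqrt k)$ as $k\to\infty$. 3. $(\mathbf y^k)$ and $(\mathbf z^k)$ converge weakly to $J_{\gamma\mathbf F}(\bar{\mathbf x})\in\operatorname{zer}(\mathbf F+\mathbf G)$. 4. If (C2) holds with $\sigma_m=0$, or if (C3) holds, then $\mathbf x^k-\mathbf y^k$ and $\mathbf x^k-\mathbf z^k$ converge strongly to $\gamma\,{}^{\gamma}\mathbf F(\bar{\mathbf x})=\bar{\mathbf x}-J_{\gamma\mathbf F}(\bar{\mathbf x})$, and $$\gamma\,{}^{\gamma}\mathbf F(\bar{\mathbf x})+\operatorname{zer}(\mathbf F+\mathbf G)=\operatorname{Fix}(T_{\mathbf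 F,\mathbf G}).$$ -/

import Mathlib

open Filter Topology Asymptotics
open scoped Pointwise

noncomputable section

namespace ComonotoneDR

/-! ### Set-valued operators on a real inner product space -/

section Operators

variable {E : Type*} [NormedAddCommGroup E] [InnerProductSpace ℝ E]

/-- `A` is `σ`-comonotone: `⟪x - y, u - v⟫ ≥ σ ‖u - v‖²` for all `(x, u), (y, v)` in the graph. -/
def IsComonotone (σ : ℝ) (A : E → Set E) : Prop :=
  ∀ x u y v : E, u ∈ A x → v ∈ A y → σ * ‖u - v‖ ^ 2 ≤ inner ℝ (x - y) (u - v)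

/-- `A` is maximal `σ`-comonotone: it is `σ`-comonotone, and every pair `(x, u)` that is related
in this way to all points of the graph already belongs to the graph. -/
def IsMaximalComonotone (σ : ℝ) (A : E → Set E) : Prop :=
  IsComonotone σ A ∧
    ∀ x u : E, (∀ y v : E, v ∈ A y → σ * ‖u - v‖ ^ 2 ≤ inner ℝ (x - y) (u - v)) → u ∈ A x

/-- The zeros of a set-valued operator. -/
def zer (A : E → Set E) : Set E := {x | (0 : E) ∈ A x}

/-- The fixed points of a set-valued operator. -/
def fixSet (T : E → Set E) : Set E := {x | x ∈ T x}

/-- The resolvent `J_{γA} = (Id + γA)⁻¹`, as a set-valued operator. -/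
def resolventOp (γ : ℝ) (A : E → Set E) (x : E) : Set E :=
  {y | ∃ u ∈ A y, y + γ • u = x}

/-- The relaxed resolvent `J_{γA}^λ = λ J_{γA} + (1 - λ) Id`. -/
def relaxedResolvent (γ lam : ℝ) (A : E → Set E) (x : E) : Set E :=
  {s | ∃ y ∈ resolventOp γ A x, s = lam • y + (1 - lam) • x}

/-- The Yosida approximation `(1/γ)(Id - J_{γA})`. -/
def yosida (γ : ℝ) (A : E → Set E) (x : E) : Set E :=
  {w | ∃ y ∈ resolventOp γ A x, w = (1 / γ) • (x - y)}

/-- The adaptive Douglas-Rachford operator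
`T_{A,B} = (1 - κ) Id + κ J_{δB}^μ J_{γA}^λ`. -/
def adrOperator (κ γ δ lam mu : ℝ) (A B : E → Set E) (x : E) : Set E :=
  {w | ∃ s ∈ relaxedResolvent γ lam A x, ∃ t ∈ relaxedResolvent δ mu B s,
    w = (1 - κ) • x + κ • t}

/-- `(x, y, z)` is generated by the adaptive Douglas-Rachford algorithm for `A, B`. -/
def IsADRSequence (κ γ δ lam mu : ℝ) (A B : E → Set E) (x y z : ℕ → E) : Prop :=
  ∀ k : ℕ, y k ∈ resolventOp γ A (x k) ∧
    z k ∈ resolventOp δ B ((1 - lam) • x k + lam • y k) ∧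
    x (k + 1) = x k + (κ * mu) • (z k - y k)

/-- The normal cone operator of a set: empty off the set. -/
def normalCone (D : Set E) (x : E) : Set E :=
  {w | x ∈ D ∧ ∀ y ∈ D, inner ℝ w (y - x) ≤ 0}

/-- Weak convergence of a sequence. -/
def WeaklyConverges (x : ℕ → E) (a : E) : Prop :=
  Tendsto (fun k => toWeakSpace ℝ E (x k)) atTop (𝓝 (toWeakSpace ℝ E a))

end Operators

/-! ### The product space reformulation

The `m = n + 1` operators are `A : Fin (n + 1) → H → Set H`; the last one, `A_m`, is
`A (Fin.last n)`, and `A_1, …, A_{m-1}` are `A i.castSucc` for `i : Fin n`.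
The product space `H^{m-1}` carries its Hilbert norm. -/

section ProductSpace

variable {H : Type*} [NormedAddCommGroup H] [InnerProductSpace ℝ H] {n : ℕ}

/-- The Hilbert space `H^n`. -/
abbrev Prod2 (H : Type*) (n : ℕ) : Type _ := PiLp 2 (fun _ : Fin n => H)

/-- The diagonal of `H^n`. -/
def diagonalSet (H : Type*) (n : ℕ) : Set (Prod2 H n) := {x | ∃ a : H, ∀ i, x i = a}

/-- `F(x) = A_1(x_1) × ⋯ × A_{m-1}(x_{m-1})`. -/
def opF (A : Fin (n + 1) → H → Set H) (x : Prod2 H n) : Set (Prod2 H n) :=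
  {w | ∀ i : Fin n, w i ∈ A i.castSucc (x i)}

/-- `K(x) = {(1/(m-1)) (v, …, v) : v ∈ A_m(a)}` if `x = (a, …, a)`, and empty off the diagonal. -/
def opK (A : Fin (n + 1) → H → Set H) (x : Prod2 H n) : Set (Prod2 H n) :=
  {w | ∃ a : H, (∀ i, x i = a) ∧ ∃ v ∈ A (Fin.last n) a, ∀ i, w i = (1 / (n : ℝ)) • v}

/-- `G = K + N_D`, with `D` the diagonal. -/
def opG (A : Fin (n + 1) → H → Set H) (x : Prod2 H n) : Set (Prod2 H n) :=
  opK A x + normalCone (diagonalSet H n) x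

end ProductSpace

/-! ### Conditions on the moduli and the parameters (with `m - 1 = n`) -/

section Conditions

variable {n : ℕ}

/-- The smallest of `σ_1, …, σ_{m-1}`. -/
def minModulus (σ : Fin (n + 1) → ℝ) : ℝ := ⨅ i : Fin n, σ i.castSucc

/-- The set `Θ` of weight vectors. -/
def weightSet (σ : Fin (n + 1) → ℝ) : Set (Fin n → ℝ) :=
  {θ | (∀ i, 0 < θ i) ∧ (∀ i, 0 < σ i.castSucc + σ (Fin.last n) * θ i) ∧ ∑ i, 1 / θ i = 1}

/-- The quantity `κ_i^*` attached to the weights `θ`. -/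
def kappaStarWeighted (γ δ : ℝ) (σ : Fin (n + 1) → ℝ) (θ : Fin n → ℝ) (i : Fin n) : ℝ :=
  (4 * (γ + σ i.castSucc) * (δ + σ (Fin.last n) * θ i) - (γ + δ) ^ 2) /
    (2 * (γ + δ) * (σ i.castSucc + σ (Fin.last n) * θ i))

/-- The bound `κ^*` on the relaxation parameter in case (C2). -/
def kappaStarC2 (γ δ : ℝ) (σ : Fin (n + 1) → ℝ) : ℝ :=
  (4 * (γ + minModulus σ) * (δ + n * σ (Fin.last n)) - (γ + δ) ^ 2) /
    (2 * (γ + δ) * (minModulus σ + n * σ (Fin.last n)))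

/-- The balanced case. -/
def CondC1 (γ δ : ℝ) (σ : Fin (n + 1) → ℝ) : Prop :=
  minModulus σ = -(n * σ (Fin.last n)) ∧ 0 ≤ -(n * σ (Fin.last n)) ∧
    δ = γ + 2 * minModulus σ

/-- The case of a strictly positive sum. -/
def CondC2 (γ δ : ℝ) (σ : Fin (n + 1) → ℝ) : Prop :=
  -(n * σ (Fin.last n)) < minModulus σ ∧ 0 ≤ -(n * σ (Fin.last n)) ∧
    (γ + δ) ^ 2 < 4 * (γ + minModulus σ) * (δ + n * σ (Fin.last n))

/-- The case `σ_1, …, σ_{m-1} > 0 > σ_m` with `∑ 1/σ_i < 0`. -/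
def CondC3 (κ γ δ lam mu : ℝ) (σ : Fin (n + 1) → ℝ) : Prop :=
  (∀ i : Fin n, 0 < σ i.castSucc) ∧ σ (Fin.last n) < 0 ∧ ∑ i, 1 / σ i < 0 ∧
    0 < κ ∧ κ < 1 ∧
    ∃ θ ∈ weightSet σ,
      (1 ≤ ⨅ i, kappaStarWeighted γ δ σ θ i) ∨
      (γ = δ ∧ lam = 2 ∧ mu = 2 ∧ κ < ⨅ i, kappaStarWeighted γ δ σ θ i)

end Conditions

end ComonotoneDR

end

open ComonotoneDR

/-!
The proof works with graph points rather than with resolvents. For `u ∈ F y`, `w ∈ G z`,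
`x = y + γ u` and `y - z = δ (u + w)`, one step of the algorithm is
`x ↦ x - κ (γ + δ) (u + w)`: it subtracts a multiple of the residual `u + w`. Its fixed points are
the `y + γ u` with `u ∈ F y` and `-u ∈ G y` (`fixSet_adrOperator`).

An element `w` belongs to `G z` exactly if `z = (a, …, a)` and `∑ w i ∈ A_m a` (`mem_opG_iff`).
Comonotonicity of the `m` operators therefore gives, for differences `Δ` of two such
configurations with `r = u + w`,
`⟪Δx, Δr⟫ ≥ ∑ σ_i ‖Δu_i‖² + σ_m ‖∑ Δw_i‖² + γ ⟪Δu, Δr⟫ + δ ⟪Δw, Δr⟫` (`le_inner_residual`).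
Since `σ_m ≤ 0` and `‖∑ Δw_i‖² ≤ ∑ θ_i ‖Δw_i‖²` when `∑ 1 / θ_i = 1`, the right side is at least a
sum of binary quadratic forms, one for each `i`. The number `κ^*` is such that these dominate
`c ‖Δr‖²` with `c = (γ + δ) κ^* / 2` (`IsCertificate.cocoercive`), and the conditions
`CondC1`, `CondC2`, `CondC3` all give `κ (γ + δ) < 2 c` (`exists_certificate`). In the balanced case
`CondC1` the weights are `θ_i = m - 1` and `κ^*` becomes `1`.

Hence the iteration is Fejér monotone with respect to the fixed points, the squared residuals are
summable, and the residuals decrease in norm, which gives the rate `o(1 / √k)`. Weak convergence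
follows from Opial's lemma (`exists_weakLim_of_fejer`), with ultrafilters in place of subsequences.
For the weak cluster points no surjectivity theorem of Minty type is needed: the sum of the `m`
comonotonicity inequalities passes to weak limits, because the pairings of weakly convergent
factors cancel up to the vanishing residual and `∑ σ_i ‖u_i‖² + σ_m ‖∑ u_i‖²` is a nonnegative
quadratic form (`inequality_of_weakLim`); and a product of maximal comonotone operators is maximal
for the summed inequality (`mem_of_forall_sum_le`). If `σ_i + σ_m θ_i > 0` for all `i`, that form is
coercive, so `u` is the same for all solutions and the convergence of `x k - y k = γ u k` is strong.
-/

noncomputable section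

namespace ComonotoneDR

/-! ### Weak limits along filters -/

section WeakLimits

variable {E : Type*} [NormedAddCommGroup E] [InnerProductSpace ℝ E]

/-- Weak convergence along an arbitrary filter, tested against inner products. -/
def WeakLim {ι : Type*} (l : Filter ι) (x : ι → E) (a : E) : Prop :=
  ∀ h : E, Tendsto (fun k => (inner ℝ (x k) h : ℝ)) l (𝓝 (inner ℝ a h))

theorem weaklyConverges_of_weakLim [CompleteSpace E] {x : ℕ → E} {a : E}
    (hx : WeakLim atTop x a) : WeaklyConverges x a := by
  have hinj : Function.Injective (topDualPairing ℝ E).flip := by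
    intro p q hpq
    have h1 := LinearMap.congr_fun hpq (innerSL ℝ (p - q))
    have h2 : (inner ℝ (p - q) p : ℝ) = inner ℝ (p - q) q := h1
    have h3 : (inner ℝ (p - q) (p - q) : ℝ) = 0 := by rw [inner_sub_right, h2, sub_self]
    exact sub_eq_zero.1 (inner_self_eq_zero.1 h3)
  refine (WeakBilin.tendsto_iff_forall_eval_tendsto (topDualPairing ℝ E).flip hinj).2 fun f => ?_
  obtain ⟨h, rfl⟩ := (InnerProductSpace.toDual ℝ E).surjective f
  have h1 := hx h
  simp only [real_inner_comm h] at h1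
  exact h1

/-- A bounded family has a weak limit along every ultrafilter: the ultralimits of the inner
products form a bounded linear functional, which is represented by a vector. -/
theorem exists_weakLim_ultrafilter [CompleteSpace E] {ι : Type*} (U : Ultrafilter ι) {x : ι → E}
    {C : ℝ} (hC : ∀ k, ‖x k‖ ≤ C) : ∃ a, WeakLim (U : Filter ι) x a := by
  have key : ∀ h : E, ∃ c : ℝ, Tendsto (fun k => (inner ℝ (x k) h : ℝ)) U (𝓝 c) := by
    intro h
    have hcpt : IsCompact (Set.Icc (-(C * ‖h‖)) (C * ‖h‖)) := isCompact_Icc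
    obtain ⟨c, -, hc⟩ := hcpt.ultrafilter_le_nhds (U.map fun k => (inner ℝ (x k) h : ℝ)) (by
      refine le_principal_iff.2 (Filter.mem_map.2 (Filter.univ_mem' fun k => ?_))
      have h1 := abs_real_inner_le_norm (x k) h
      have h2 := mul_le_mul_of_nonneg_right (hC k) (norm_nonneg h)
      exact abs_le.1 (h1.trans h2))
    exact ⟨c, hc⟩
  choose φ hφ using key
  let L : E →ₗ[ℝ] ℝ :=
    { toFun := φ
      map_add' := fun p q => tendsto_nhds_unique (hφ (p + q)) (by
        simpa only [inner_add_right] using (hφ p).add (hφ q))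
      map_smul' := fun c p => tendsto_nhds_unique (hφ (c • p)) (by
        simpa only [real_inner_smul_right, smul_eq_mul, RingHom.id_apply] using
          (hφ p).const_mul c) }
  let f : StrongDual ℝ E := L.mkContinuous C fun h => by
    refine le_of_tendsto (hφ h).norm (Filter.univ_mem' fun k => ?_)
    exact (abs_real_inner_le_norm (x k) h).trans
      (mul_le_mul_of_nonneg_right (hC k) (norm_nonneg h))
  refine ⟨(InnerProductSpace.toDual ℝ E).symm f, fun h => ?_⟩
  rw [InnerProductSpace.toDual_symm_apply]
  exact hφ h

theorem WeakLim.unique {ι : Type*} {l : Filter ι} [l.NeBot] {x : ι → E} {a b : E}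
    (ha : WeakLim l x a) (hb : WeakLim l x b) : a = b :=
  ext_inner_right ℝ fun h => tendsto_nhds_unique (ha h) (hb h)

theorem WeakLim.add {ι : Type*} {l : Filter ι} {x y : ι → E} {a b : E}
    (ha : WeakLim l x a) (hb : WeakLim l y b) : WeakLim l (fun k => x k + y k) (a + b) :=
  fun h => by simpa only [inner_add_left] using (ha h).add (hb h)

theorem WeakLim.const_smul {ι : Type*} {l : Filter ι} {x : ι → E} {a : E} (c : ℝ)
    (ha : WeakLim l x a) : WeakLim l (fun k => c • x k) (c • a) :=
  fun h => by simpa only [real_inner_smul_left] using (ha h).const_mul c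

theorem weakLim_of_forall_ultrafilter {ι : Type*} {l : Filter ι} {x : ι → E} {a : E}
    (h : ∀ U : Ultrafilter ι, (U : Filter ι) ≤ l → WeakLim (U : Filter ι) x a) : WeakLim l x a :=
  fun p => (tendsto_iff_ultrafilter _ _ _).2 fun U hU => h U hU p

theorem WeakLim.mono {ι : Type*} {l l' : Filter ι} {x : ι → E} {a : E} (hx : WeakLim l x a)
    (h : l' ≤ l) : WeakLim l' x a :=
  fun p => (hx p).mono_left h

theorem weakLim_of_tendsto {ι : Type*} {l : Filter ι} {x : ι → E} {a : E}
    (ha : Tendsto x l (𝓝 a)) : WeakLim l x a :=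
  fun _ => ha.inner tendsto_const_nhds

/-- Inner products of a null sequence with a bounded one tend to zero. -/
theorem tendsto_inner_zero_of_bounded {ι : Type*} {l : Filter ι} {r u : ι → E} {C : ℝ}
    (hr : Tendsto r l (𝓝 0)) (hu : ∀ k, ‖u k‖ ≤ C) :
    Tendsto (fun k => (inner ℝ (r k) (u k) : ℝ)) l (𝓝 0) := by
  have h1 : Tendsto (fun k => ‖r k‖ * C) l (𝓝 0) := by
    simpa using hr.norm.mul_const C
  refine squeeze_zero_norm (fun k => ?_) h1
  exact (abs_real_inner_le_norm _ _).trans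
    (mul_le_mul_of_nonneg_left (hu k) (norm_nonneg _))

theorem norm_le_of_antitone_dist {V : Type*} [SeminormedAddCommGroup V] {x : ℕ → V} {p : V}
    (hx : ∀ k, ‖x (k + 1) - p‖ ≤ ‖x k - p‖) (k : ℕ) : ‖x k‖ ≤ ‖x 0 - p‖ + ‖p‖ := by
  have h1 : ‖x k - p‖ ≤ ‖x 0 - p‖ := antitone_nat_of_succ_le (f := fun k => ‖x k - p‖) hx k.zero_le
  have h2 : ‖x k‖ ≤ ‖x k - p‖ + ‖p‖ := by simpa using norm_add_le (x k - p) p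
  linarith

/-- **Opial's lemma**: a sequence that is Fejér monotone with respect to a nonempty set `Z`, and
whose weak cluster points (along ultrafilters) all lie in `Z`, converges weakly to a point
of `Z`. -/
theorem exists_weakLim_of_fejer [CompleteSpace E] {x : ℕ → E} {Z : Set E} (hZ : Z.Nonempty)
    (hfejer : ∀ p ∈ Z, ∀ k, ‖x (k + 1) - p‖ ≤ ‖x k - p‖)
    (hcl : ∀ U : Ultrafilter ℕ, (U : Filter ℕ) ≤ atTop → ∀ p, WeakLim (U : Filter ℕ) x p → p ∈ Z) :
    ∃ p ∈ Z, WeakLim atTop x p := by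
  obtain ⟨p₀, hp₀⟩ := hZ
  have hbd := norm_le_of_antitone_dist (hfejer p₀ hp₀)
  have hconv : ∀ p ∈ Z, ∃ c, Tendsto (fun k => ‖x k - p‖ ^ 2) atTop (𝓝 c) := fun p hp =>
    ⟨_, (tendsto_atTop_ciInf (antitone_nat_of_succ_le (f := fun k => ‖x k - p‖) (hfejer p hp))
      ⟨0, by rintro _ ⟨k, rfl⟩; exact norm_nonneg _⟩).pow 2⟩
  have huniq : ∀ (U V : Ultrafilter ℕ), (U : Filter ℕ) ≤ atTop → (V : Filter ℕ) ≤ atTop →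
      ∀ p q, WeakLim (U : Filter ℕ) x p → WeakLim (V : Filter ℕ) x q → p = q := by
    intro U V hU hV p q hp hq
    obtain ⟨c, hc⟩ := hconv p (hcl U hU p hp)
    obtain ⟨d, hd⟩ := hconv q (hcl V hV q hq)
    -- `⟪x k, p - q⟫` is a combination of the two convergent squared distances
    have h1 : Tendsto (fun k => (inner ℝ (x k) (p - q) : ℝ)) atTop
        (𝓝 ((d - c - (‖q‖ ^ 2 - ‖p‖ ^ 2)) / 2)) := by
      refine (((hd.sub hc).sub_const (‖q‖ ^ 2 - ‖p‖ ^ 2)).div_const 2).congr fun k => ?_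
      rw [norm_sub_sq_real, norm_sub_sq_real, inner_sub_right]
      ring
    have h2 := tendsto_nhds_unique (hp (p - q)) (h1.mono_left hU)
    have h3 := tendsto_nhds_unique (hq (p - q)) (h1.mono_left hV)
    have h4 : (inner ℝ (p - q) (p - q) : ℝ) = 0 := by rw [inner_sub_left, h2, h3, sub_self]
    exact sub_eq_zero.1 (inner_self_eq_zero.1 h4)
  obtain ⟨p, hp⟩ := exists_weakLim_ultrafilter (hyperfilter ℕ) hbd
  have hle : (hyperfilter ℕ : Filter ℕ) ≤ atTop := Nat.hyperfilter_le_atTop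
  refine ⟨p, hcl _ hle p hp, weakLim_of_forall_ultrafilter fun U hU => ?_⟩
  obtain ⟨q, hq⟩ := exists_weakLim_ultrafilter U hbd
  rw [huniq _ _ hle hU p q hp hq]
  exact hq

end WeakLimits

/-! ### A rate for antitone summable sequences -/

/-- If `a` is antitone, nonnegative, with bounded partial sums, then `k * a k → 0`: the terms
from `k / 2` to `k` are all at least `a k`, and their sum is a Cauchy difference. -/
theorem tendsto_mul_of_antitone_of_sum_le {a : ℕ → ℝ} (ha : Antitone a) (h0 : ∀ k, 0 ≤ a k)
    {C : ℝ} (hC : ∀ N, ∑ k ∈ Finset.range N, a k ≤ C) :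
    Tendsto (fun k : ℕ => (k : ℝ) * a k) atTop (𝓝 0) := by
  have hs : Summable a := summable_of_sum_range_le h0 hC
  have hS := hs.hasSum.tendsto_sum_nat
  have hhalf : Tendsto (fun k : ℕ => k / 2) atTop atTop :=
    Nat.tendsto_div_const_atTop (by norm_num)
  have hlim := ((hS.sub (hS.comp hhalf)).const_mul 2)
  rw [sub_self, mul_zero] at hlim
  refine squeeze_zero (fun k => mul_nonneg (Nat.cast_nonneg k) (h0 k)) (fun k => ?_) hlim
  have h1 : ((k - k / 2 : ℕ) : ℝ) * a k ≤ ∑ j ∈ Finset.Ico (k / 2) k, a j := by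
    have h2 := Finset.card_nsmul_le_sum (Finset.Ico (k / 2) k) a (a k)
      (fun j hj => ha (Finset.mem_Ico.1 hj).2.le)
    simpa using h2
  have h3 : (k : ℝ) ≤ 2 * ((k - k / 2 : ℕ) : ℝ) := by
    have : k ≤ 2 * (k - k / 2) := by omega
    exact_mod_cast this
  rw [Finset.sum_Ico_eq_sub _ (Nat.div_le_self k 2)] at h1
  have h4 := mul_le_mul_of_nonneg_right h3 (h0 k)
  simp only [Function.comp_apply]
  linarith

theorem isLittleO_one_div_sqrt_of_sq_le {b a : ℕ → ℝ} (hb0 : ∀ k, 0 ≤ b k) (hb : ∀ k, b k ^ 2 ≤ a k)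
    (ha : Tendsto (fun k : ℕ => (k : ℝ) * a k) atTop (𝓝 0)) :
    b =o[atTop] (fun k : ℕ => 1 / Real.sqrt k) := by
  have h1 : Tendsto (fun k : ℕ => b k / (1 / Real.sqrt k)) atTop (𝓝 0) := by
    have h2 : Tendsto (fun k : ℕ => Real.sqrt ((k : ℝ) * a k)) atTop (𝓝 0) := by
      have h3 := (Real.continuous_sqrt.tendsto 0).comp ha
      rwa [Real.sqrt_zero] at h3
    refine squeeze_zero (fun k => div_nonneg (hb0 k) (by positivity)) (fun k => ?_) h2
    rw [div_div_eq_mul_div, div_one, Real.sqrt_mul (Nat.cast_nonneg k), mul_comm]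
    exact mul_le_mul_of_nonneg_left (Real.le_sqrt_of_sq_le (hb k)) (Real.sqrt_nonneg _)
  refine (isLittleO_iff_tendsto' ?_).2 h1
  filter_upwards [eventually_gt_atTop 0] with k hk h
  have : 0 < Real.sqrt (k : ℝ) := Real.sqrt_pos.2 (by exact_mod_cast hk)
  exact absurd h (by positivity)

/-! ### Relaxed fixed-point iterations with a cocoercive residual -/

section Iteration

variable {E : Type*} [NormedAddCommGroup E] [InnerProductSpace ℝ E]

theorem norm_sub_smul_sq_le {c t : ℝ} (ht : 0 ≤ t) {x r : E} (h : c * ‖r‖ ^ 2 ≤ inner ℝ x r) :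
    ‖x - t • r‖ ^ 2 ≤ ‖x‖ ^ 2 - t * (2 * c - t) * ‖r‖ ^ 2 := by
  rw [norm_sub_sq_real, real_inner_smul_right, norm_smul, mul_pow, Real.norm_eq_abs, sq_abs]
  nlinarith [mul_le_mul_of_nonneg_left h ht]

theorem norm_sub_smul_le {c t : ℝ} (ht : 0 ≤ t) (htc : t ≤ 2 * c) {x r : E}
    (h : c * ‖r‖ ^ 2 ≤ inner ℝ x r) : ‖x - t • r‖ ≤ ‖x‖ := by
  have h1 := norm_sub_smul_sq_le ht h
  have h2 : 0 ≤ t * (2 * c - t) * ‖r‖ ^ 2 := by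
    have : 0 ≤ 2 * c - t := by linarith
    positivity
  exact (sq_le_sq₀ (norm_nonneg _) (norm_nonneg _)).1 (h1.trans (by linarith))

/-- Summing the Fejér inequality bounds the partial sums of the squared residuals. -/
theorem summable_residual {c t : ℝ} (ht : 0 < t) (htc : t < 2 * c) {x r : ℕ → E} {p : E}
    (hstep : ∀ k, x (k + 1) = x k - t • r k)
    (hp : ∀ k, c * ‖r k‖ ^ 2 ≤ inner ℝ (x k - p) (r k)) : Summable fun k => ‖r k‖ ^ 2 := by
  have hρ : 0 < t * (2 * c - t) := mul_pos ht (by linarith)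
  have hsum : ∀ N, t * (2 * c - t) * ∑ k ∈ Finset.range N, ‖r k‖ ^ 2
      ≤ ‖x 0 - p‖ ^ 2 - ‖x N - p‖ ^ 2 := by
    intro N
    induction N with
    | zero => simp
    | succ N ih =>
      have h1 := norm_sub_smul_sq_le ht.le (hp N)
      rw [sub_right_comm, ← hstep] at h1
      rw [Finset.sum_range_succ, mul_add]
      linarith
  refine summable_of_sum_range_le (c := ‖x 0 - p‖ ^ 2 / (t * (2 * c - t)))
    (fun _ => by positivity) fun N => ?_
  rw [le_div_iff₀' hρ]
  have := hsum N
  have : 0 ≤ ‖x N - p‖ ^ 2 := by positivity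
  linarith

/-- Successive differences are `-t • r k`; they decrease in norm and are square summable. -/
theorem tendsto_mul_sq_norm_sub_succ {c t : ℝ} (ht : 0 < t) (htc : t < 2 * c) {x r : ℕ → E} {p : E}
    (hstep : ∀ k, x (k + 1) = x k - t • r k)
    (hp : ∀ k, c * ‖r k‖ ^ 2 ≤ inner ℝ (x k - p) (r k))
    (hsucc : ∀ k, c * ‖r k - r (k + 1)‖ ^ 2 ≤ inner ℝ (x k - x (k + 1)) (r k - r (k + 1))) :
    Tendsto (fun k : ℕ => (k : ℝ) * ‖x k - x (k + 1)‖ ^ 2) atTop (𝓝 0) := by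
  have hs := summable_residual ht htc hstep hp
  have hd : ∀ k, ‖x k - x (k + 1)‖ ^ 2 = t ^ 2 * ‖r k‖ ^ 2 := fun k => by
    rw [hstep, sub_sub_cancel, norm_smul, mul_pow, Real.norm_eq_abs, sq_abs]
  have hanti : Antitone fun k => ‖x k - x (k + 1)‖ ^ 2 := antitone_nat_of_succ_le fun k => by
    have h1 := norm_sub_smul_le ht.le htc.le (hsucc k)
    have h2 : x k - x (k + 1) - t • (r k - r (k + 1)) = x (k + 1) - x (k + 1 + 1) := by
      rw [hstep (k + 1), hstep k, smul_sub]; abel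
    rw [h2] at h1
    gcongr
  refine tendsto_mul_of_antitone_of_sum_le hanti (fun _ => by positivity)
    (C := ∑' k, t ^ 2 * ‖r k‖ ^ 2) fun N => ?_
  simp only [hd]
  exact (hs.mul_left (t ^ 2)).sum_le_tsum _ fun _ _ => by positivity

theorem tendsto_residual {c t : ℝ} (ht : 0 < t) (htc : t < 2 * c) {x r : ℕ → E} {p : E}
    (hstep : ∀ k, x (k + 1) = x k - t • r k)
    (hp : ∀ k, c * ‖r k‖ ^ 2 ≤ inner ℝ (x k - p) (r k)) : Tendsto r atTop (𝓝 0) := by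
  have h1 := (summable_residual ht htc hstep hp).tendsto_atTop_zero.sqrt
  simp only [Real.sqrt_sq (norm_nonneg _), Real.sqrt_zero] at h1
  exact tendsto_zero_iff_norm_tendsto_zero.2 h1

end Iteration

/-! ### The adaptive Douglas-Rachford operator in terms of graph points -/

section Splitting

variable {E : Type*} [NormedAddCommGroup E] [InnerProductSpace ℝ E]

/-- The points `y + γ u` with `u ∈ A y` and `-u ∈ B y`. -/
def solutionPoints (γ : ℝ) (A B : E → Set E) : Set E :=
  {x | ∃ y u, u ∈ A y ∧ -u ∈ B y ∧ y + γ • u = x}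

theorem relaxation_eq {γ δ lam : ℝ} (hpar2 : δ = γ * (lam - 1)) {x y u : E} (hx : y + γ • u = x) :
    (1 - lam) • x + lam • y = y - δ • u := by
  rw [← hx, hpar2]; module

theorem mul_delta_eq {γ δ lam mu : ℝ} (hpar1 : (lam - 1) * (mu - 1) = 1)
    (hpar2 : δ = γ * (lam - 1)) : mu * δ = γ + δ := by
  rw [hpar2]; linear_combination γ * hpar1

/-- The algorithm in terms of graph points `u k ∈ A (y k)` and `w k ∈ B (z k)`: it subtracts from
`x k` a multiple of the residual `u k + w k`. -/
theorem IsADRSequence.exists_graph {κ γ δ lam mu : ℝ} (hpar1 : (lam - 1) * (mu - 1) = 1)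
    (hpar2 : δ = γ * (lam - 1)) {A B : E → Set E} {x y z : ℕ → E}
    (h : IsADRSequence κ γ δ lam mu A B x y z) :
    ∃ u w : ℕ → E, ∀ k, u k ∈ A (y k) ∧ w k ∈ B (z k) ∧ y k + γ • u k = x k ∧
      y k - z k = δ • (u k + w k) ∧ x (k + 1) = x k - (κ * (γ + δ)) • (u k + w k) := by
  have hy : ∀ k, ∃ u ∈ A (y k), y k + γ • u = x k := fun k => (h k).1
  have hz : ∀ k, ∃ w ∈ B (z k), z k + δ • w = (1 - lam) • x k + lam • y k := fun k => (h k).2.1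
  choose u hu hxu using hy
  choose w hw hzw using hz
  refine ⟨u, w, fun k => ?_⟩
  have h1 : y k - z k = δ • (u k + w k) := by
    have h2 := hzw k
    rw [relaxation_eq hpar2 (hxu k)] at h2
    rw [smul_add, eq_sub_of_add_eq h2]; abel
  refine ⟨hu k, hw k, hxu k, h1, ?_⟩
  rw [(h k).2.2, ← neg_sub (y k), h1, smul_neg, smul_smul, mul_assoc,
    mul_delta_eq hpar1 hpar2, sub_eq_add_neg]

theorem relaxed_step_eq {κ γ δ mu : ℝ} (hmd : mu * δ = γ + δ) {y u z w : E}
    (hz : z + δ • w = y - δ • u) :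
    (1 - κ) • (y + γ • u) + κ • (mu • z + (1 - mu) • (y - δ • u)) =
      y + γ • u - (κ * (γ + δ)) • (u + w) := by
  obtain rfl : z = y - δ • u - δ • w := eq_sub_of_add_eq hz
  obtain rfl : γ = mu * δ - δ := by linarith
  module

theorem fixSet_adrOperator {κ γ δ lam mu : ℝ} (hκ : 0 < κ) (hγ : 0 < γ) (hδ : 0 < δ)
    (hpar1 : (lam - 1) * (mu - 1) = 1) (hpar2 : δ = γ * (lam - 1)) (A B : E → Set E) :
    fixSet (adrOperator κ γ δ lam mu A B) = solutionPoints γ A B := by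
  have hmd := mul_delta_eq hpar1 hpar2
  ext x
  constructor
  · rintro ⟨s, ⟨y, ⟨u, hu, hyx⟩, rfl⟩, t, ⟨z, ⟨w, hw, hzs⟩, rfl⟩, hx⟩
    rw [add_comm (lam • y), relaxation_eq hpar2 hyx] at hzs hx
    rw [← hyx, relaxed_step_eq hmd hzs, eq_comm, sub_eq_self] at hx
    have h2 : u + w = 0 := (smul_eq_zero.1 hx).resolve_left (by positivity)
    obtain rfl : w = -u := (neg_eq_of_add_eq_zero_right h2).symm
    obtain rfl : z = y := by
      rw [smul_neg, ← sub_eq_add_neg] at hzs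
      exact sub_left_injective hzs
    exact ⟨z, u, hu, hw, hyx⟩
  · rintro ⟨y, u, hu, hw, rfl⟩
    have hs : lam • y + (1 - lam) • (y + γ • u) = y - δ • u := by
      rw [add_comm, relaxation_eq hpar2 rfl]
    have hz : y + δ • -u = y - δ • u := by rw [smul_neg, sub_eq_add_neg]
    refine ⟨_, ⟨y, ⟨u, hu, rfl⟩, rfl⟩, _, ⟨y, ⟨-u, hw, hz.trans hs.symm⟩, rfl⟩, ?_⟩
    rw [hs, relaxed_step_eq hmd hz, add_neg_cancel, smul_zero, sub_zero]

theorem mem_zer_add_iff {E : Type*} [NormedAddCommGroup E] {A B : E → Set E} {y : E} :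
    y ∈ zer (A + B) ↔ ∃ u ∈ A y, -u ∈ B y := by
  constructor
  · rintro ⟨u, hu, w, hw, h⟩
    exact ⟨u, hu, by rwa [← eq_neg_of_add_eq_zero_right h]⟩
  · rintro ⟨u, hu, hw⟩
    exact ⟨u, hu, -u, hw, add_neg_cancel u⟩

/-- The weak closedness behind the convergence proof. Let `S` and `P` be such that the form
`⟪S q, q⟫ + τ ‖P q‖²` is nonnegative. An inequality between graph points along a filter, in which the
residual `r k` vanishes, passes to the weak limits of `a k` and `u k`: the pairings of two weakly
convergent factors cancel because `D` is the adjoint of `P`, and the form is weakly lower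
semicontinuous. -/
theorem inequality_of_weakLim {V : Type*} [NormedAddCommGroup V] [InnerProductSpace ℝ V]
    {ι : Type*} {l : Filter ι} [l.NeBot] {S : E →ₗ[ℝ] E} (hS : ∀ p q, inner ℝ (S p) q = inner ℝ (S q) p)
    {P : E →L[ℝ] V} {D : V →ₗ[ℝ] E} (hD : ∀ a w, inner ℝ (D a) w = inner ℝ a (P w)) {τ δ C : ℝ}
    (hpos : ∀ q, 0 ≤ inner ℝ (S q) q + τ * ‖P q‖ ^ 2) {u r : ι → E} {a : ι → V} {u₀ : E} {a₀ : V}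
    (hr : Tendsto r l (𝓝 0)) (hu : WeakLim l u u₀) (ha : WeakLim l a a₀) (hub : ∀ k, ‖u k‖ ≤ C)
    (hab : ∀ k, ‖a k‖ ≤ C) {y' u' : E} {a' v' : V}
    (hineq : ∀ k, inner ℝ (S (u k - u')) (u k - u') + τ * ‖P (r k - u k) - v'‖ ^ 2 ≤
      inner ℝ (D (a k) + δ • r k - y') (u k - u') + inner ℝ (a k - a') (P (r k - u k) - v')) :
    inner ℝ (S (u₀ - u')) (u₀ - u') + τ * ‖P (-u₀) - v'‖ ^ 2 ≤
      inner ℝ (D a₀ - y') (u₀ - u') + inner ℝ (a₀ - a') (P (-u₀) - v') := by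
  have hPr : Tendsto (fun k => P (r k)) l (𝓝 0) := by
    have h1 := (P.continuous.tendsto 0).comp hr
    rwa [map_zero] at h1
  have hPu : ∀ k, ‖P (u k)‖ ≤ ‖P‖ * C := fun k =>
    (P.le_opNorm _).trans (mul_le_mul_of_nonneg_left (hub k) (norm_nonneg _))
  have hu' : ∀ h, Tendsto (fun k => (inner ℝ h (u k) : ℝ)) l (𝓝 (inner ℝ h u₀)) := fun h => by
    simpa only [real_inner_comm h] using hu h
  -- terms that vanish with the residual
  have e1 := tendsto_inner_zero_of_bounded hr hub
  have e2 := tendsto_inner_zero_of_bounded hr (u := fun _ => u') fun _ => le_rfl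
  have e3 := tendsto_inner_zero_of_bounded hPr hab
  have e4 := tendsto_inner_zero_of_bounded hPr hPu
  have e5 := tendsto_inner_zero_of_bounded hPr (u := fun _ => v') fun _ => le_rfl
  have e6 : Tendsto (fun k => ‖P (r k)‖ ^ 2) l (𝓝 0) := by simpa using hPr.norm.pow 2
  have e7 := tendsto_inner_zero_of_bounded hPr (u := fun _ => a') fun _ => le_rfl
  -- minorize `⟪S (u k), u k⟫ + τ ‖P (u k)‖²` by its tangent at `u₀`; what remains is affine
  have hlim := (((((((e1.sub e2).const_mul δ).add e3).sub e7).sub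
    (((e6.sub (e5.const_mul 2)).sub (e4.const_mul 2)).const_mul τ)).add
    ((hu' (2 • S u' + D a' - y' - (2 * τ) • D v' - 2 • S u₀ - (2 * τ) • D (P u₀))).sub
      (ha (P u' + v')))).add_const
    (inner ℝ y' u' + inner ℝ a' v' - inner ℝ (S u') u' - τ * ‖v'‖ ^ 2 + inner ℝ (S u₀) u₀
      + τ * ‖P u₀‖ ^ 2))
  have hnonneg := ge_of_tendsto' hlim (b := 0) fun k => by
    have h1 := hineq k
    have h2 := hpos (u k - u₀)
    simp only [map_sub, inner_sub_left, inner_sub_right, inner_add_left, inner_add_right,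
      real_inner_smul_left, hD, norm_sub_sq_real, two_smul, hS (u k) u₀, hS (u k) u',
      real_inner_comm v' (P (u k)), real_inner_comm (P u₀) (P (u k)),
      real_inner_comm (a k) (P (r k)), real_inner_comm a' (P (r k))] at h1 h2 ⊢
    linarith
  simp only [map_sub, map_neg, inner_sub_left, inner_sub_right, inner_add_left, inner_add_right,
    real_inner_smul_left, hD, norm_sub_sq_real, two_smul, inner_neg_left, inner_neg_right, norm_neg,
    real_inner_self_eq_norm_sq, hS u₀ u', real_inner_comm v' (P u₀)] at hnonneg ⊢
  linarith

end Splitting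

/-! ### Comonotone families and the product space -/

section Families

variable {H : Type*} [NormedAddCommGroup H] [InnerProductSpace ℝ H]

/-- A product of maximal comonotone operators is maximal with respect to the sum of the
comonotonicity inequalities. If some factor fails, its maximality yields a graph point violating that
factor's inequality, while in the other factors either the point itself (giving equality) or
another violating graph point is available; the sum is then violated. -/
theorem mem_of_forall_sum_le {ι : Type*} [Fintype ι] {σ : ι → ℝ} {A : ι → H → Set H}
    (hA : ∀ i, IsMaximalComonotone (σ i) (A i)) {x u : ι → H}
    (h : ∀ x' u' : ι → H, (∀ i, u' i ∈ A i (x' i)) →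
      ∑ i, σ i * ‖u i - u' i‖ ^ 2 ≤ ∑ i, (inner ℝ (x i - x' i) (u i - u' i) : ℝ)) (i : ι) :
    u i ∈ A i (x i) := by
  have key : ∀ i, ∃ x' u', u' ∈ A i x' ∧
      (inner ℝ (x i - x') (u i - u') : ℝ) ≤ σ i * ‖u i - u'‖ ^ 2 ∧
      (u i ∉ A i (x i) → (inner ℝ (x i - x') (u i - u') : ℝ) < σ i * ‖u i - u'‖ ^ 2) := by
    intro i
    by_cases hi : u i ∈ A i (x i)
    · exact ⟨x i, u i, hi, by simp, fun h => absurd hi h⟩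
    · have h1 := mt ((hA i).2 (x i) (u i)) hi
      push Not at h1
      obtain ⟨x', u', hu', hlt⟩ := h1
      exact ⟨x', u', hu', hlt.le, fun _ => hlt⟩
  choose x' u' hmem hle hlt using key
  by_contra hi
  exact absurd (h x' u' hmem) (not_le.2 (Finset.sum_lt_sum (fun j _ => hle j)
    ⟨i, Finset.mem_univ i, hlt i hi⟩))

/-- Weighted Cauchy-Schwarz: `‖∑ v i‖² ≤ ∑ θ i ‖v i‖²` when `∑ 1 / θ i = 1`. -/
theorem norm_sum_sq_le_sum_mul {V : Type*} [SeminormedAddCommGroup V] {ι : Type*} [Fintype ι]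
    {θ : ι → ℝ} (hθ : ∀ i, 0 < θ i)
    (hsum : ∑ i, 1 / θ i = 1) (v : ι → V) :
    ‖∑ i, v i‖ ^ 2 ≤ ∑ i, θ i * ‖v i‖ ^ 2 := by
  have h1 : ‖∑ i, v i‖ ^ 2 ≤ (∑ i, ‖v i‖) ^ 2 := by
    gcongr
    exact norm_sum_le _ _
  have h2 := Finset.sum_sq_le_sum_mul_sum_of_sq_le_mul Finset.univ (r := fun i => ‖v i‖)
    (f := fun i => 1 / θ i) (g := fun i => θ i * ‖v i‖ ^ 2)
    (fun i _ => (one_div_pos.2 (hθ i)).le) (fun i _ => mul_nonneg (hθ i).le (sq_nonneg _))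
    (fun i _ => by rw [← mul_assoc, one_div_mul_cancel (hθ i).ne', one_mul])
  rw [hsum, one_mul] at h2
  exact h1.trans h2

/-- A positive semidefinite binary quadratic form stays nonnegative on pairs of vectors. -/
theorem quadratic_form_nonneg {p q h : ℝ} (hp : 0 ≤ p) (hq : 0 ≤ q) (hpq : h ^ 2 ≤ p * q) (u w : H) :
    0 ≤ p * ‖u‖ ^ 2 + q * ‖w‖ ^ 2 + 2 * h * inner ℝ u w := by
  have h1 : (2 * h * inner ℝ u w) ^ 2 ≤ (p * ‖u‖ ^ 2 + q * ‖w‖ ^ 2) ^ 2 := by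
    have h2 : (inner ℝ u w : ℝ) ^ 2 ≤ ‖u‖ ^ 2 * ‖w‖ ^ 2 := by
      rw [← mul_pow, ← sq_abs (inner ℝ u w : ℝ)]
      gcongr
      exact abs_real_inner_le_norm u w
    have h3 : h ^ 2 * (inner ℝ u w : ℝ) ^ 2 ≤ p * q * (‖u‖ ^ 2 * ‖w‖ ^ 2) :=
      mul_le_mul hpq h2 (sq_nonneg _) (mul_nonneg hp hq)
    nlinarith [sq_nonneg (p * ‖u‖ ^ 2 - q * ‖w‖ ^ 2)]
  have := (abs_le.1 (abs_le_of_sq_le_sq h1 (by positivity))).1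
  linarith

end Families

section ProductSpace

variable {H : Type*} [NormedAddCommGroup H] [InnerProductSpace ℝ H] {n : ℕ}

/-- The diagonal embedding `a ↦ (a, …, a)`. -/
def diagL (H : Type*) [NormedAddCommGroup H] [InnerProductSpace ℝ H] (n : ℕ) :
    H →ₗ[ℝ] Prod2 H n where
  toFun a := WithLp.toLp 2 fun _ => a
  map_add' _ _ := rfl
  map_smul' _ _ := rfl

/-- The sum of the components, the adjoint of the diagonal embedding. -/
def sumL (H : Type*) [NormedAddCommGroup H] [InnerProductSpace ℝ H] (n : ℕ) :
    Prod2 H n →L[ℝ] H :=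
  ∑ i, PiLp.proj 2 (fun _ : Fin n => H) i

/-- Componentwise multiplication by the moduli `σ_1, …, σ_{m-1}`. -/
def moduliL (H : Type*) [NormedAddCommGroup H] [InnerProductSpace ℝ H] (σ : Fin (n + 1) → ℝ) :
    Prod2 H n →ₗ[ℝ] Prod2 H n where
  toFun u := WithLp.toLp 2 fun i => σ i.castSucc • u i
  map_add' _ _ := by ext; simp
  map_smul' c _ := by ext i; exact smul_comm (σ i.castSucc) c _

@[simp] theorem diagL_apply (a : H) (i : Fin n) : diagL H n a i = a := rfl

theorem sumL_apply (u : Prod2 H n) : sumL H n u = ∑ i, u i := by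
  simp [sumL]

@[simp] theorem moduliL_apply (σ : Fin (n + 1) → ℝ) (u : Prod2 H n) (i : Fin n) :
    moduliL H σ u i = σ i.castSucc • u i := rfl

theorem inner_diagL (a : H) (w : Prod2 H n) :
    (inner ℝ (diagL H n a) w : ℝ) = inner ℝ a (sumL H n w) := by
  simp [PiLp.inner_apply, sumL_apply, inner_sum]

theorem inner_moduliL_comm (σ : Fin (n + 1) → ℝ) (p q : Prod2 H n) :
    (inner ℝ (moduliL H σ p) q : ℝ) = inner ℝ (moduliL H σ q) p := by
  simp only [PiLp.inner_apply, moduliL_apply, real_inner_smul_left]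
  exact Finset.sum_congr rfl fun i _ => by rw [real_inner_comm]

theorem inner_moduliL_self (σ : Fin (n + 1) → ℝ) (q : Prod2 H n) :
    (inner ℝ (moduliL H σ q) q : ℝ) = ∑ i, σ i.castSucc * ‖q i‖ ^ 2 := by
  simp [PiLp.inner_apply, real_inner_smul_left]

theorem mem_opG_iff (hn : 1 ≤ n) {A : Fin (n + 1) → H → Set H} {z w : Prod2 H n} :
    w ∈ opG A z ↔ ∃ a, z = diagL H n a ∧ sumL H n w ∈ A (Fin.last n) a := by
  have hn0 : (n : ℝ) ≠ 0 := by positivity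
  constructor
  · rintro ⟨k, ⟨a, hza, v, hv, hk⟩, d, ⟨-, hd⟩, rfl⟩
    have hz : z = diagL H n a := PiLp.ext hza
    refine ⟨a, hz, ?_⟩
    have hd0 : sumL H n d = 0 := by
      have h1 := hd (z + diagL H n (sumL H n d)) ⟨a + sumL H n d, fun i => by simp [hza i]⟩
      rw [add_sub_cancel_left, real_inner_comm, inner_diagL, real_inner_self_eq_norm_sq] at h1
      exact norm_eq_zero.1 (pow_eq_zero_iff two_ne_zero |>.1 (le_antisymm h1 (sq_nonneg _)))
    have hkv : sumL H n k = v := by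
      rw [sumL_apply, Finset.sum_congr rfl fun i _ => hk i, Finset.sum_const, Finset.card_univ,
        Fintype.card_fin, ← Nat.cast_smul_eq_nsmul ℝ, smul_smul, mul_one_div_cancel hn0, one_smul]
    change sumL H n (k + d) ∈ _
    rwa [map_add, hd0, add_zero, hkv]
  · rintro ⟨a, rfl, hw⟩
    refine ⟨diagL H n ((1 / (n : ℝ)) • sumL H n w), ⟨a, fun _ => rfl, _, hw, fun _ => rfl⟩,
      w - diagL H n ((1 / (n : ℝ)) • sumL H n w), ⟨⟨a, fun _ => rfl⟩, ?_⟩, add_sub_cancel _ _⟩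
    rintro y ⟨b, hb⟩
    have hy : y = diagL H n b := PiLp.ext hb
    have h1 : sumL H n (diagL H n ((1 / (n : ℝ)) • sumL H n w)) = sumL H n w := by
      rw [sumL_apply]
      simp only [diagL_apply]
      rw [Finset.sum_const, Finset.card_univ,
        Fintype.card_fin, ← Nat.cast_smul_eq_nsmul ℝ, smul_smul, mul_one_div_cancel hn0, one_smul]
    rw [hy, ← map_sub, real_inner_comm, inner_diagL, map_sub, h1, sub_self, inner_zero_right]

variable {A : Fin (n + 1) → H → Set H} {σ : Fin (n + 1) → ℝ}

theorem opF_inner_ge (hA : ∀ i, IsComonotone (σ i) (A i)) {y y' u u' : Prod2 H n}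
    (hu : u ∈ opF A y) (hu' : u' ∈ opF A y') :
    inner ℝ (moduliL H σ (u - u')) (u - u') ≤ inner ℝ (y - y') (u - u') := by
  rw [inner_moduliL_self, PiLp.inner_apply]
  exact Finset.sum_le_sum fun i _ => hA i.castSucc _ _ _ _ (hu i) (hu' i)

theorem opG_inner_ge (hn : 1 ≤ n) (hA : ∀ i, IsComonotone (σ i) (A i)) {z z' w w' : Prod2 H n}
    (hw : w ∈ opG A z) (hw' : w' ∈ opG A z') :
    σ (Fin.last n) * ‖sumL H n (w - w')‖ ^ 2 ≤ inner ℝ (z - z') (w - w') := by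
  obtain ⟨a, rfl, ha⟩ := (mem_opG_iff hn).1 hw
  obtain ⟨a', rfl, ha'⟩ := (mem_opG_iff hn).1 hw'
  rw [← map_sub, inner_diagL, map_sub]
  exact hA _ _ _ _ _ ha ha'

/-- The pairing of the difference of two points `x = y + γ u` with the difference of their
residuals `u + w` dominates a quadratic form in the differences of `u` and `w`. -/
theorem le_inner_residual (hn : 1 ≤ n) (hA : ∀ i, IsComonotone (σ i) (A i)) {γ δ : ℝ}
    {y z u w y' z' u' w' : Prod2 H n}
    (hu : u ∈ opF A y) (hw : w ∈ opG A z) (hyz : y - z = δ • (u + w))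
    (hu' : u' ∈ opF A y') (hw' : w' ∈ opG A z') (hyz' : y' - z' = δ • (u' + w')) :
    inner ℝ (moduliL H σ (u - u')) (u - u') + σ (Fin.last n) * ‖sumL H n (w - w')‖ ^ 2 +
      γ * inner ℝ (u - u') (u + w - (u' + w')) + δ * inner ℝ (w - w') (u + w - (u' + w')) ≤
    inner ℝ (y + γ • u - (y' + γ • u')) (u + w - (u' + w')) := by
  have h1 := opF_inner_ge hA hu hu'
  have h2 := opG_inner_ge hn hA hw hw'
  have h3 : y - y' = z - z' + δ • (u + w - (u' + w')) := by
    rw [smul_sub, ← hyz, ← hyz']; abel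
  have h4 : y + γ • u - (y' + γ • u') = y - y' + γ • (u - u') := by module
  have h5 : u + w - (u' + w') = (u - u') + (w - w') := by abel
  have h6 : (inner ℝ (y - y') (u + w - (u' + w')) : ℝ) =
      inner ℝ (y - y') (u - u') + (inner ℝ (z - z') (w - w') +
        δ * inner ℝ (w - w') (u + w - (u' + w'))) := by
    rw [← real_inner_smul_left, real_inner_comm _ (δ • (w - w')), real_inner_smul_right,
      ← real_inner_smul_left, ← inner_add_left, ← h3]
    rw [← inner_add_right, ← h5]
  rw [h4, inner_add_left, real_inner_smul_left, h6]
  linarith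

/-- Maximality of the product of all `m` operators, in the form used for weak limits. -/
theorem mem_opF_and_mem_last (hA : ∀ i, IsMaximalComonotone (σ i) (A i)) {y u : Prod2 H n} {a v : H}
    (h : ∀ (y' u' : Prod2 H n) (a' v' : H), u' ∈ opF A y' → v' ∈ A (Fin.last n) a' →
      inner ℝ (moduliL H σ (u - u')) (u - u') + σ (Fin.last n) * ‖v - v'‖ ^ 2 ≤
        inner ℝ (y - y') (u - u') + inner ℝ (a - a') (v - v')) :
    u ∈ opF A y ∧ v ∈ A (Fin.last n) a := by
  have key := mem_of_forall_sum_le hA (x := Fin.snoc (α := fun _ => H) y a)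
    (u := Fin.snoc (α := fun _ => H) u v) fun x' u' hmem => by
      have h1 := h (WithLp.toLp 2 fun i => x' i.castSucc) (WithLp.toLp 2 fun i => u' i.castSucc)
        (x' (Fin.last n)) (u' (Fin.last n)) (fun i => hmem i.castSucc) (hmem _)
      rw [inner_moduliL_self, PiLp.inner_apply] at h1
      simpa [Fin.sum_univ_castSucc] using h1
  exact ⟨fun i => by simpa using key i.castSucc, by simpa using key (Fin.last n)⟩

end ProductSpace

/-! ### Certificates for the moduli -/

section Certificates

variable {H : Type*} [NormedAddCommGroup H] [InnerProductSpace ℝ H] {n : ℕ}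

/-- What each of `CondC1`, `CondC2`, `CondC3` provides: lower bounds `s i ≥ 0` for the moduli of
`A_1, …, A_{m-1}` and weights `θ` such that `c ‖u + w‖²` is dominated, for each `i`, by the quadratic
form `(γ + s i) ‖u‖² + (δ + σ_m θ_i) ‖w‖² + (γ + δ) ⟪u, w⟫` (positive semidefiniteness of the
difference, by its diagonal and its determinant). -/
structure IsCertificate (γ δ c : ℝ) (σ : Fin (n + 1) → ℝ) (s θ : Fin n → ℝ) : Prop where
  s_nonneg : ∀ i, 0 ≤ s i
  s_le : ∀ i, s i ≤ σ i.castSucc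
  last_nonpos : σ (Fin.last n) ≤ 0
  weight_pos : ∀ i, 0 < θ i
  weight_sum : ∑ i, 1 / θ i = 1
  add_nonneg : ∀ i, 0 ≤ s i + σ (Fin.last n) * θ i
  left_nonneg : ∀ i, 0 ≤ γ + s i - c
  right_nonneg : ∀ i, 0 ≤ δ + σ (Fin.last n) * θ i - c
  det_nonneg : ∀ i, ((γ + δ) / 2 - c) ^ 2 ≤ (γ + s i - c) * (δ + σ (Fin.last n) * θ i - c)

variable {γ δ c : ℝ} {σ : Fin (n + 1) → ℝ} {s θ : Fin n → ℝ}

theorem IsCertificate.sum_le (h : IsCertificate γ δ c σ s θ) (q p : Prod2 H n) :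
    ∑ i, (s i * ‖q i‖ ^ 2 + σ (Fin.last n) * θ i * ‖p i‖ ^ 2) ≤
      inner ℝ (moduliL H σ q) q + σ (Fin.last n) * ‖sumL H n p‖ ^ 2 := by
  rw [inner_moduliL_self, sumL_apply, Finset.sum_add_distrib]
  refine add_le_add (Finset.sum_le_sum fun i _ => ?_) ?_
  · exact mul_le_mul_of_nonneg_right (h.s_le i) (sq_nonneg _)
  · have h1 := mul_le_mul_of_nonpos_left
      (norm_sum_sq_le_sum_mul h.weight_pos h.weight_sum fun i => p i) h.last_nonpos
    simpa only [Finset.mul_sum, mul_assoc] using h1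

theorem IsCertificate.form_nonneg (h : IsCertificate γ δ c σ s θ) (q : Prod2 H n) :
    0 ≤ inner ℝ (moduliL H σ q) q + σ (Fin.last n) * ‖sumL H n q‖ ^ 2 := by
  refine le_trans (Finset.sum_nonneg fun i _ => ?_) (h.sum_le q q)
  rw [← add_mul]
  exact mul_nonneg (h.add_nonneg i) (sq_nonneg _)

theorem IsCertificate.exists_form_ge (h : IsCertificate γ δ c σ s θ) (hn : 1 ≤ n)
    (hpos : ∀ i, 0 < s i + σ (Fin.last n) * θ i) :
    ∃ m > 0, ∀ q : Prod2 H n,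
      m * ‖q‖ ^ 2 ≤ inner ℝ (moduliL H σ q) q + σ (Fin.last n) * ‖sumL H n q‖ ^ 2 := by
  have : Nonempty (Fin n) := ⟨⟨0, hn⟩⟩
  obtain ⟨j, hj⟩ := Finite.exists_min fun i => s i + σ (Fin.last n) * θ i
  refine ⟨_, hpos j, fun q => le_trans ?_ (h.sum_le q q)⟩
  rw [PiLp.norm_sq_eq_of_L2, Finset.mul_sum]
  refine Finset.sum_le_sum fun i _ => ?_
  rw [← add_mul]
  exact mul_le_mul_of_nonneg_right (hj i) (sq_nonneg _)

/-- The residual `u + w` is `c`-cocoercive as a function of `x = y + γ u`. -/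
theorem IsCertificate.cocoercive (h : IsCertificate γ δ c σ s θ) (hn : 1 ≤ n)
    {A : Fin (n + 1) → H → Set H} (hA : ∀ i, IsComonotone (σ i) (A i))
    {y z u w y' z' u' w' : Prod2 H n}
    (hu : u ∈ opF A y) (hw : w ∈ opG A z) (hyz : y - z = δ • (u + w))
    (hu' : u' ∈ opF A y') (hw' : w' ∈ opG A z') (hyz' : y' - z' = δ • (u' + w')) :
    c * ‖u + w - (u' + w')‖ ^ 2 ≤
      inner ℝ (y + γ • u - (y' + γ • u')) (u + w - (u' + w')) := by
  have h1 := le_inner_residual (γ := γ) hn hA hu hw hyz hu' hw' hyz'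
  have h2 := h.sum_le (u - u') (w - w')
  have h5 : u + w - (u' + w') = (u - u') + (w - w') := by abel
  rw [h5] at h1 ⊢
  generalize u - u' = p at *
  generalize w - w' = q at *
  have h3 : c * ‖p + q‖ ^ 2 ≤ ∑ i, (s i * ‖p i‖ ^ 2 + σ (Fin.last n) * θ i * ‖q i‖ ^ 2) +
      γ * inner ℝ p (p + q) + δ * inner ℝ q (p + q) := by
    rw [PiLp.norm_sq_eq_of_L2, PiLp.inner_apply, PiLp.inner_apply, Finset.mul_sum, Finset.mul_sum,
      Finset.mul_sum, ← Finset.sum_add_distrib, ← Finset.sum_add_distrib]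
    refine Finset.sum_le_sum fun i _ => ?_
    have h4 := quadratic_form_nonneg (h.left_nonneg i) (h.right_nonneg i) (h.det_nonneg i) (p i) (q i)
    rw [PiLp.add_apply, norm_add_sq_real, inner_add_right, inner_add_right,
      real_inner_self_eq_norm_sq, real_inner_self_eq_norm_sq, real_inner_comm (p i) (q i)]
    linarith
  linarith

/-- For `s + τ > 0`, the defining bound of `κ^*` makes `(γ + δ) κ / 2` admissible as the
cocoercivity constant. -/
theorem certificate_of_le_kappaStar {γ δ k s τ : ℝ} (hγδ : 0 < γ + δ) (hs : 0 < s + τ)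
    (hk : k ≤ (4 * (γ + s) * (δ + τ) - (γ + δ) ^ 2) / (2 * (γ + δ) * (s + τ))) :
    0 ≤ γ + s - (γ + δ) / 2 * k ∧ 0 ≤ δ + τ - (γ + δ) / 2 * k ∧
      ((γ + δ) / 2 - (γ + δ) / 2 * k) ^ 2 ≤
        (γ + s - (γ + δ) / 2 * k) * (δ + τ - (γ + δ) / 2 * k) := by
  rw [le_div_iff₀ (by positivity)] at hk
  have hdet : ((γ + δ) / 2 - (γ + δ) / 2 * k) ^ 2 ≤
      (γ + s - (γ + δ) / 2 * k) * (δ + τ - (γ + δ) / 2 * k) := by nlinarith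
  set p := γ + s - (γ + δ) / 2 * k with hp
  set q := δ + τ - (γ + δ) / 2 * k with hq
  set e := (γ + δ) / 2 - (γ + δ) / 2 * k with he
  have hpq : 2 * e < p + q := by rw [hp, hq, he]; linarith
  -- a negative trace would give `(2 e)² > (p + q)² ≥ 4 p q ≥ 4 e²`
  have htr : 0 ≤ p + q := by
    by_contra hneg
    nlinarith [sq_nonneg (p - q)]
  have hprod : 0 ≤ p * q := (sq_nonneg e).trans hdet
  refine ⟨?_, ?_, hdet⟩
  · by_contra hneg
    nlinarith [sq_nonneg q]
  · by_contra hneg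
    nlinarith [sq_nonneg p]

theorem minModulus_le (σ : Fin (n + 1) → ℝ) (i : Fin n) : minModulus σ ≤ σ i.castSucc :=
  ciInf_le (Set.finite_range _).bddBelow i

/-- Each of the three conditions provides a certificate with `κ (γ + δ) < 2 c`; the inequalities
`0 ≤ s i + σ_m θ_i` are strict under `CondC2` and under `CondC3`. -/
theorem exists_certificate {κ γ δ lam mu : ℝ} {σ : Fin (n + 1) → ℝ} (hn : 1 ≤ n) (hγ : 0 < γ)
    (hδ : 0 < δ)
    (hcond : (CondC1 γ δ σ ∧ κ < 1) ∨ (CondC2 γ δ σ ∧ κ < kappaStarC2 γ δ σ) ∨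
      CondC3 κ γ δ lam mu σ) :
    ∃ c s θ, IsCertificate γ δ c σ s θ ∧ κ * (γ + δ) < 2 * c ∧
      (CondC2 γ δ σ ∨ CondC3 κ γ δ lam mu σ → ∀ i, 0 < s i + σ (Fin.last n) * θ i) := by
  have hγδ : 0 < γ + δ := add_pos hγ hδ
  have hn0 : (0 : ℝ) < n := by exact_mod_cast hn
  have : Nonempty (Fin n) := ⟨⟨0, hn⟩⟩
  have hweight : ∑ _i : Fin n, 1 / (n : ℝ) = 1 := by simp [hn0.ne']
  have hlast : 0 ≤ -(n * σ (Fin.last n)) → σ (Fin.last n) ≤ 0 := fun h => by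
    by_contra hneg
    have := mul_pos hn0 (not_le.1 hneg)
    linarith
  -- `CondC3` can hold together with `CondC1`; only its own certificate is strict
  by_cases h3 : CondC3 κ γ δ lam mu σ
  · obtain ⟨hσ, hσm, -, -, hκ1, θ, ⟨hθ, hθσ, hθsum⟩, hθκ⟩ := h3
    have hκk : κ < ⨅ i, kappaStarWeighted γ δ σ θ i := by
      rcases hθκ with h | ⟨-, -, -, h⟩
      · exact hκ1.trans_le h
      · exact h
    have hcert := fun i => certificate_of_le_kappaStar hγδ (hθσ i)
      (ciInf_le (Set.finite_range (kappaStarWeighted γ δ σ θ)).bddBelow i)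
    refine ⟨(γ + δ) / 2 * ⨅ i, kappaStarWeighted γ δ σ θ i, fun i => σ i.castSucc, θ,
      ⟨fun i => (hσ i).le, fun _ => le_rfl, hσm.le, hθ, hθsum, fun i => (hθσ i).le,
        fun i => (hcert i).1, fun i => (hcert i).2.1, fun i => (hcert i).2.2⟩, ?_, fun _ => hθσ⟩
    have := mul_lt_mul_of_pos_right hκk hγδ
    linarith
  rcases hcond with ⟨h1, hκ1⟩ | ⟨h2, hκ2⟩ | h
  · obtain ⟨hbal, hσm, hδγ⟩ := h1
    have hτ : σ (Fin.last n) * n = -minModulus σ := by rw [hbal]; ring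
    refine ⟨(γ + δ) / 2, fun _ => minModulus σ, fun _ => n,
      ⟨fun _ => hbal ▸ hσm, minModulus_le σ, hlast hσm, fun _ => hn0, hweight, fun _ => ?_,
        fun _ => ?_, fun _ => ?_, fun _ => ?_⟩, ?_, ?_⟩
    · rw [hτ, add_neg_cancel]
    · linarith
    · rw [hτ]; linarith
    · rw [hτ, hδγ]; apply le_of_eq; ring
    · have := mul_lt_mul_of_pos_right hκ1 hγδ
      linarith
    · rintro (⟨hlt, -, -⟩ | h)
      · exact absurd hbal hlt.ne'
      · exact absurd h h3
  · obtain ⟨hlt, hσm, -⟩ := h2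
    have hpos : 0 < minModulus σ + n * σ (Fin.last n) := by linarith
    obtain ⟨hl, hr, hdet⟩ := certificate_of_le_kappaStar hγδ hpos (le_refl (kappaStarC2 γ δ σ))
    rw [mul_comm (n : ℝ)] at hpos hr hdet
    refine ⟨(γ + δ) / 2 * kappaStarC2 γ δ σ, fun _ => minModulus σ, fun _ => n,
      ⟨fun _ => hσm.trans hlt.le, minModulus_le σ, hlast hσm, fun _ => hn0, hweight,
        fun _ => hpos.le, fun _ => hl, fun _ => hr, fun _ => hdet⟩, ?_, fun _ _ => hpos⟩
    have := mul_lt_mul_of_pos_right hκ2 hγδ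
    linarith
  · exact absurd h h3

end Certificates

/-! ### Convergence of the algorithm -/

section Convergence

theorem norm_le_norm_add_smul {E : Type*} [NormedAddCommGroup E] [InnerProductSpace ℝ E] {γ : ℝ}
    (hγ : 0 ≤ γ) {p q : E} (h : 0 ≤ (inner ℝ p q : ℝ)) : ‖p‖ ≤ ‖p + γ • q‖ := by
  refine (sq_le_sq₀ (norm_nonneg _) (norm_nonneg _)).1 ?_
  rw [norm_add_sq_real, real_inner_smul_right]
  nlinarith [sq_nonneg ‖γ • q‖, mul_nonneg hγ h]

variable {H : Type*} [NormedAddCommGroup H] [InnerProductSpace ℝ H] {n : ℕ}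
  {γ δ c : ℝ} {σ : Fin (n + 1) → ℝ} {s θ : Fin n → ℝ} {A : Fin (n + 1) → H → Set H}

theorem solutionPoints_nonempty (hn : 1 ≤ n) (γ : ℝ) (hzer : (zer (∑ i, A i)).Nonempty) :
    (solutionPoints γ (opF A) (opG A)).Nonempty := by
  obtain ⟨a, ha⟩ := hzer
  have ha' : (0 : H) ∈ ∑ i, A i a := by
    have h1 : (0 : H) ∈ (∑ i, A i) a := ha
    rwa [Finset.sum_apply] at h1
  obtain ⟨g, hg, hsum⟩ := Set.mem_finsetSum _ _ _ |>.1 ha'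
  rw [Fin.sum_univ_castSucc] at hsum
  refine ⟨_, diagL H n a, WithLp.toLp 2 fun i => g i.castSucc, fun i => hg (Finset.mem_univ _),
    (mem_opG_iff hn).2 ⟨a, rfl, ?_⟩, rfl⟩
  rw [map_neg, sumL_apply, neg_eq_of_add_eq_zero_right hsum]
  exact hg (Finset.mem_univ _)

/-- The resolvent `J_{γF}` is nonexpansive, the moduli of `A_1, …, A_{m-1}` being nonnegative. -/
theorem IsCertificate.norm_resolvent_sub_le (h : IsCertificate γ δ c σ s θ) (hγ : 0 ≤ γ)
    (hA : ∀ i, IsComonotone (σ i) (A i)) {y y' u u' : Prod2 H n}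
    (hu : u ∈ opF A y) (hu' : u' ∈ opF A y') : ‖y - y'‖ ≤ ‖y + γ • u - (y' + γ • u')‖ := by
  have h1 := opF_inner_ge hA hu hu'
  have h2 : 0 ≤ (inner ℝ (moduliL H σ (u - u')) (u - u') : ℝ) := by
    rw [inner_moduliL_self]
    exact Finset.sum_nonneg fun i _ =>
      mul_nonneg ((h.s_nonneg i).trans (h.s_le i)) (sq_nonneg _)
  rw [add_sub_add_comm, ← smul_sub]
  exact norm_le_norm_add_smul hγ (h2.trans h1)

theorem IsCertificate.eq_of_add_smul_eq (h : IsCertificate γ δ c σ s θ) (hγ : 0 ≤ γ)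
    (hA : ∀ i, IsComonotone (σ i) (A i)) {y y' u u' : Prod2 H n}
    (hu : u ∈ opF A y) (hu' : u' ∈ opF A y') (heq : y + γ • u = y' + γ • u') : y = y' := by
  have h1 := h.norm_resolvent_sub_le hγ hA hu hu'
  rw [heq, sub_self, norm_zero] at h1
  exact sub_eq_zero.1 (norm_le_zero_iff.1 h1)

theorem IsCertificate.exists_bound (h : IsCertificate γ δ c σ s θ) (hγ : 0 < γ)
    (hA : ∀ i, IsComonotone (σ i) (A i)) {x y u : ℕ → Prod2 H n} (hu : ∀ k, u k ∈ opF A (y k))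
    (hx : ∀ k, y k + γ • u k = x k) {C : ℝ} (hC : ∀ k, ‖x k‖ ≤ C) :
    ∃ B, (∀ k, ‖y k‖ ≤ B) ∧ ∀ k, ‖u k‖ ≤ B := by
  have hyb : ∀ k, ‖y k‖ ≤ C + C + ‖y 0‖ := fun k => by
    have h1 := h.norm_resolvent_sub_le hγ.le hA (hu k) (hu 0)
    rw [hx, hx] at h1
    have h2 := norm_sub_le (x k) (x 0)
    have h3 : ‖y k‖ ≤ ‖y k - y 0‖ + ‖y 0‖ := by simpa using norm_add_le (y k - y 0) (y 0)
    linarith [hC k, hC 0]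
  have hub : ∀ k, ‖u k‖ ≤ γ⁻¹ * (C + (C + C + ‖y 0‖)) := fun k => by
    have h1 : u k = γ⁻¹ • (x k - y k) := by
      rw [← hx k, add_sub_cancel_left, inv_smul_smul₀ hγ.ne']
    rw [h1, norm_smul, Real.norm_of_nonneg (inv_nonneg.2 hγ.le)]
    have h2 := norm_sub_le (x k) (y k)
    refine mul_le_mul_of_nonneg_left ?_ (inv_nonneg.2 hγ.le)
    linarith [hC k, hyb k]
  exact ⟨_, fun k => (hyb k).trans (le_max_left _ _), fun k => (hub k).trans (le_max_right _ _)⟩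

/-- If the residuals `u k + w k` vanish, every weak cluster point of `y k + γ u k` is a solution
point `y₀ + γ u₀`, and `y k` converges weakly to `y₀` along the same ultrafilter. -/
theorem IsCertificate.exists_solution_of_weakLim [CompleteSpace H] (h : IsCertificate γ δ c σ s θ)
    (hn : 1 ≤ n) (hγ : 0 < γ) (hA : ∀ i, IsMaximalComonotone (σ i) (A i))
    {x y z u w : ℕ → Prod2 H n}
    (hu : ∀ k, u k ∈ opF A (y k)) (hw : ∀ k, w k ∈ opG A (z k)) (hx : ∀ k, y k + γ • u k = x k)
    (hyz : ∀ k, y k - z k = δ • (u k + w k)) (hr : Tendsto (fun k => u k + w k) atTop (𝓝 0))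
    {C : ℝ} (hC : ∀ k, ‖x k‖ ≤ C) {U : Ultrafilter ℕ} (hU : (U : Filter ℕ) ≤ atTop) {p : Prod2 H n}
    (hp : WeakLim (U : Filter ℕ) x p) :
    ∃ y₀ u₀, u₀ ∈ opF A y₀ ∧ -u₀ ∈ opG A y₀ ∧ y₀ + γ • u₀ = p ∧ WeakLim (U : Filter ℕ) y y₀ := by
  have hA' := fun i => (hA i).1
  choose a hza haw using fun k => (mem_opG_iff hn).1 (hw k)
  obtain ⟨R, hR⟩ := hr.norm.bddAbove_range
  have hR' : ∀ k, ‖u k + w k‖ ≤ R := fun k => hR ⟨k, rfl⟩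
  obtain ⟨B, hyb, hub⟩ := h.exists_bound hγ hA' hu hx hC
  have hab : ∀ k, ‖a k‖ ≤ B + |δ| * R := fun k => by
    have h1 : ‖a k‖ ≤ ‖z k‖ := by
      have h2 := PiLp.norm_apply_le (z k) (⟨0, hn⟩ : Fin n)
      rwa [hza k, diagL_apply, ← hza k] at h2
    have h2 : ‖z k‖ ≤ ‖y k‖ + ‖δ • (u k + w k)‖ := by
      rw [← hyz k]
      simpa using norm_sub_le (y k) (y k - z k)
    rw [norm_smul, Real.norm_eq_abs] at h2
    linarith [mul_le_mul_of_nonneg_left (hR' k) (abs_nonneg δ), hyb k]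
  obtain ⟨u₀, hu₀⟩ := exists_weakLim_ultrafilter U hub
  obtain ⟨a₀, ha₀⟩ := exists_weakLim_ultrafilter U hab
  have hrU := hr.mono_left hU
  have hya : ∀ k, diagL H n (a k) + δ • (u k + w k) = y k := fun k => by
    rw [← hza k, ← hyz k, add_sub_cancel]
  have hy₀ : WeakLim (U : Filter ℕ) y (diagL H n a₀) := by
    have h1 : WeakLim (U : Filter ℕ) (fun k => diagL H n (a k)) (diagL H n a₀) := fun q => by
      simpa only [inner_diagL] using ha₀ (sumL H n q)
    have h2 := h1.add ((weakLim_of_tendsto hrU).const_smul δ)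
    simpa only [hya, smul_zero, add_zero] using h2
  have hp₀ : diagL H n a₀ + γ • u₀ = p := by
    have h1 := hy₀.add (hu₀.const_smul γ)
    simp only [hx] at h1
    exact h1.unique hp
  obtain ⟨hmemF, hmemG⟩ := mem_opF_and_mem_last hA (y := diagL H n a₀) (u := u₀) (a := a₀)
    (v := sumL H n (-u₀)) fun y' u' a' v' hu' hv' =>
      inequality_of_weakLim (δ := δ) (inner_moduliL_comm σ) inner_diagL h.form_nonneg hrU hu₀ ha₀
        (fun k => (hub k).trans (le_max_left _ _)) (fun k => (hab k).trans (le_max_right _ _))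
        fun k => by
          rw [hya, add_sub_cancel_left]
          exact add_le_add (opF_inner_ge hA' (hu k) hu') (hA' _ _ _ _ _ (haw k) hv')
  exact ⟨_, u₀, hmemF, (mem_opG_iff hn).2 ⟨a₀, rfl, hmemG⟩, hp₀, hy₀⟩

/-- If the comonotonicity form is coercive, the component `u` is the same for all solutions. -/
theorem eq_of_solutions (hn : 1 ≤ n) (hA : ∀ i, IsComonotone (σ i) (A i)) {m : ℝ} (hm : 0 < m)
    (hform : ∀ q : Prod2 H n,
      m * ‖q‖ ^ 2 ≤ inner ℝ (moduliL H σ q) q + σ (Fin.last n) * ‖sumL H n q‖ ^ 2)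
    {y y' u u' : Prod2 H n} (hu : u ∈ opF A y) (hw : -u ∈ opG A y) (hu' : u' ∈ opF A y')
    (hw' : -u' ∈ opG A y') : u = u' := by
  have h1 := le_inner_residual (γ := 0) (δ := 0) hn hA hu hw (by simp) hu' hw' (by simp)
  have h2 : -u - -u' = -(u - u') := by abel
  rw [h2, map_neg, norm_neg, add_neg_cancel, add_neg_cancel, sub_zero, inner_zero_right,
    inner_zero_right, inner_zero_right, mul_zero, add_zero, add_zero] at h1
  have h3 : ‖u - u'‖ ^ 2 ≤ 0 := by
    have := (hform (u - u')).trans h1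
    by_contra hneg
    have := mul_pos hm (not_le.1 hneg)
    linarith
  exact sub_eq_zero.1 (norm_eq_zero.1 (pow_eq_zero_iff two_ne_zero |>.1
    (le_antisymm h3 (sq_nonneg _))))

/-- If the comonotonicity form is coercive, vanishing residuals force `u k` to converge strongly:
the pairing of `x k - x̄` with the residual tends to zero and dominates `m ‖u k - ū‖²` up to terms
that contain the residual. -/
theorem tendsto_of_form_ge (hn : 1 ≤ n) (hA : ∀ i, IsComonotone (σ i) (A i)) {m : ℝ} (hm : 0 < m)
    (hform : ∀ q : Prod2 H n,
      m * ‖q‖ ^ 2 ≤ inner ℝ (moduliL H σ q) q + σ (Fin.last n) * ‖sumL H n q‖ ^ 2)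
    {x y z u w : ℕ → Prod2 H n} (hu : ∀ k, u k ∈ opF A (y k)) (hw : ∀ k, w k ∈ opG A (z k))
    (hx : ∀ k, y k + γ • u k = x k) (hyz : ∀ k, y k - z k = δ • (u k + w k))
    (hr : Tendsto (fun k => u k + w k) atTop (𝓝 0)) {C : ℝ} (hxC : ∀ k, ‖x k‖ ≤ C)
    (huC : ∀ k, ‖u k‖ ≤ C) {y₀ u₀ : Prod2 H n} (hu₀ : u₀ ∈ opF A y₀) (hw₀ : -u₀ ∈ opG A y₀) :
    Tendsto u atTop (𝓝 u₀) := by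
  have hPr : Tendsto (fun k => sumL H n (u k + w k)) atTop (𝓝 0) := by
    have h1 := ((sumL H n).continuous.tendsto 0).comp hr
    rwa [map_zero] at h1
  have hdu : ∀ k, ‖u k - u₀‖ ≤ C + ‖u₀‖ := fun k =>
    (norm_sub_le _ _).trans (by linarith [huC k])
  have hPu : ∀ k, ‖sumL H n (u k - u₀)‖ ≤ ‖sumL H n‖ * (C + ‖u₀‖) := fun k =>
    ((sumL H n).le_opNorm _).trans (mul_le_mul_of_nonneg_left (hdu k) (norm_nonneg _))
  have e1 := tendsto_inner_zero_of_bounded hr (u := fun k => x k - (y₀ + γ • u₀)) fun k =>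
    (norm_sub_le _ _).trans (add_le_add_left (hxC k) ‖y₀ + γ • u₀‖)
  have e2 := tendsto_inner_zero_of_bounded hr hdu
  have e3 : Tendsto (fun k => ‖u k + w k‖ ^ 2) atTop (𝓝 0) := by simpa using hr.norm.pow 2
  have e4 : Tendsto (fun k => ‖sumL H n (u k + w k)‖ ^ 2) atTop (𝓝 0) := by
    simpa using hPr.norm.pow 2
  have e5 := tendsto_inner_zero_of_bounded hPr hPu
  have hlim := ((((e1.add (e2.const_mul (δ - γ))).sub (e3.const_mul δ)).sub
    (e4.const_mul (σ (Fin.last n)))).add (e5.const_mul (2 * σ (Fin.last n)))).div_const m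
  have hsq : Tendsto (fun k => ‖u k - u₀‖ ^ 2) atTop (𝓝 0) := by
    refine squeeze_zero (fun _ => sq_nonneg _) (fun k => ?_) (hlim.trans (by simp))
    have h1 := le_inner_residual (γ := γ) hn hA (hu k) (hw k) (hyz k) hu₀ hw₀ (by simp)
    have h2 := hform (u k - u₀)
    have h3 : w k - -u₀ = (u k + w k) - (u k - u₀) := by abel
    rw [hx, add_neg_cancel, sub_zero, h3, map_sub (sumL H n) (u k + w k), norm_sub_sq_real,
      inner_sub_left (u k + w k), real_inner_self_eq_norm_sq, real_inner_comm (u k + w k) (u k - u₀),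
      real_inner_comm (u k + w k) (x k - _)] at h1
    rw [le_div_iff₀' hm]
    linarith
  have h4 := hsq.sqrt
  simp only [Real.sqrt_sq (norm_nonneg _), Real.sqrt_zero] at h4
  exact tendsto_iff_norm_sub_tendsto_zero.2 h4

end Convergence

end ComonotoneDR

end

theorem mainTheorem1 {H : Type*} [NormedAddCommGroup H] [InnerProductSpace ℝ H] [CompleteSpace H]
    (n : ℕ) (hn : 1 ≤ n)
    (A : Fin (n + 1) → H → Set H) (σ : Fin (n + 1) → ℝ)
    (hA : ∀ i, IsMaximalComonotone (σ i) (A i))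
    (hzer : (zer (∑ i, A i)).Nonempty)
    (κ γ δ lam mu : ℝ) (hγ : 0 < γ) (hδ : 0 < δ) (hlam : 0 < lam) (hmu : 0 < mu)
    (hpar1 : (lam - 1) * (mu - 1) = 1) (hpar2 : δ = γ * (lam - 1))
    (hκ : 0 < κ)
    (hcond : (CondC1 γ δ σ ∧ κ < 1) ∨ (CondC2 γ δ σ ∧ κ < kappaStarC2 γ δ σ) ∨
      CondC3 κ γ δ lam mu σ)
    (x y z : ℕ → Prod2 H n)
    (hseq : IsADRSequence κ γ δ lam mu (opF A) (opG A) x y z) :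
    ∃ xbar ybar : Prod2 H n,
      (xbar ∈ fixSet (adrOperator κ γ δ lam mu (opF A) (opG A)) ∧
        resolventOp γ (opF A) xbar = {ybar} ∧
        ybar ∈ zer (opF A + opG A) ∧
        WeaklyConverges x xbar) ∧
      ((fun k : ℕ => ‖x k - x (k + 1)‖) =o[atTop] (fun k : ℕ => 1 / Real.sqrt k) ∧
        (fun k : ℕ => ‖y k - y (k + 1)‖) =o[atTop] (fun k : ℕ => 1 / Real.sqrt k)) ∧
      (WeaklyConverges y ybar ∧ WeaklyConverges z ybar) ∧
      ((CondC2 γ δ σ ∧ σ (Fin.last n) = 0) ∨ CondC3 κ γ δ lam mu σ →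
        γ • yosida γ (opF A) xbar = {xbar - ybar} ∧
        Tendsto (fun k => x k - y k) atTop (𝓝 (xbar - ybar)) ∧
        Tendsto (fun k => x k - z k) atTop (𝓝 (xbar - ybar)) ∧
        γ • yosida γ (opF A) xbar + zer (opF A + opG A) =
          fixSet (adrOperator κ γ δ lam mu (opF A) (opG A))) := by
  have hA' := fun i => (hA i).1
  have hγδ : 0 < γ + δ := add_pos hγ hδ
  obtain ⟨c, s, θ, hc, hκc, hstrict⟩ := exists_certificate hn hγ hδ hcond
  have ht : 0 < κ * (γ + δ) := mul_pos hκ hγδ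
  obtain ⟨u, w, huw⟩ := hseq.exists_graph hpar1 hpar2
  simp only [forall_and] at huw
  obtain ⟨hu, hw, hx, hyz, hstep⟩ := huw
  -- the two instances of cocoercivity that drive the iteration
  have hfix : ∀ y' u', u' ∈ opF A y' → -u' ∈ opG A y' → ∀ k,
      c * ‖u k + w k‖ ^ 2 ≤ inner ℝ (x k - (y' + γ • u')) (u k + w k) := fun y' u' hu' hw' k => by
    have h1 := hc.cocoercive hn hA' (hu k) (hw k) (hyz k) hu' hw' (by simp)
    rwa [hx, add_neg_cancel, sub_zero] at h1
  have hsucc : ∀ k, c * ‖u k + w k - (u (k + 1) + w (k + 1))‖ ^ 2 ≤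
      inner ℝ (x k - x (k + 1)) (u k + w k - (u (k + 1) + w (k + 1))) := fun k => by
    have h1 := hc.cocoercive hn hA' (hu k) (hw k) (hyz k) (hu (k + 1)) (hw (k + 1)) (hyz (k + 1))
    rwa [hx, hx] at h1
  have hZ := solutionPoints_nonempty hn γ hzer
  have hfejer : ∀ p ∈ solutionPoints γ (opF A) (opG A), ∀ k, ‖x (k + 1) - p‖ ≤ ‖x k - p‖ := by
    rintro _ ⟨y', u', hu', hw', rfl⟩ k
    have h1 := norm_sub_smul_le ht.le hκc.le (hfix y' u' hu' hw' k)
    rwa [sub_right_comm, ← hstep] at h1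
  obtain ⟨p₀, hp₀⟩ := hZ
  have hxb := norm_le_of_antitone_dist (hfejer p₀ hp₀)
  have hr : Tendsto (fun k => u k + w k) atTop (𝓝 0) := by
    obtain ⟨y', u', hu', hw', -⟩ := hp₀
    exact tendsto_residual ht hκc hstep (hfix y' u' hu' hw')
  have hcluster := fun U hU p hp =>
    hc.exists_solution_of_weakLim hn hγ hA hu hw hx hyz hr hxb (U := U) hU (p := p) hp
  obtain ⟨xbar, ⟨ybar, ubar, hubar, hwbar, hxbar⟩, hxlim⟩ :=
    exists_weakLim_of_fejer ⟨p₀, hp₀⟩ hfejer fun U hU p hp => by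
      obtain ⟨y', u', hu', hw', hp', -⟩ := hcluster U hU p hp
      exact ⟨y', u', hu', hw', hp'⟩
  have hylim : WeakLim atTop y ybar := weakLim_of_forall_ultrafilter fun U hU => by
    obtain ⟨y', u', hu', -, hp', hy'⟩ := hcluster U hU xbar (hxlim.mono hU)
    rwa [hc.eq_of_add_smul_eq hγ.le hA' hu' hubar (hp'.trans hxbar.symm)] at hy'
  have hzlim : WeakLim atTop z ybar := by
    have h1 := hylim.add ((weakLim_of_tendsto hr).const_smul (-δ))
    have h2 : ∀ k, y k + -δ • (u k + w k) = z k := fun k => by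
      rw [neg_smul, ← hyz, ← sub_eq_add_neg, sub_sub_cancel]
    simpa only [h2, smul_zero, add_zero] using h1
  have hrate := tendsto_mul_sq_norm_sub_succ ht hκc hstep (hfix ybar ubar hubar hwbar) hsucc
  have hres : resolventOp γ (opF A) xbar = {ybar} := by
    ext y'
    constructor
    · rintro ⟨u', hu', h1⟩
      exact hc.eq_of_add_smul_eq hγ.le hA' hu' hubar (h1.trans hxbar.symm)
    · rintro rfl
      exact ⟨ubar, hubar, hxbar⟩
  have hfixset := fixSet_adrOperator hκ hγ hδ hpar1 hpar2 (opF A) (opG A)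
  refine ⟨xbar, ybar, ⟨?_, hres, mem_zer_add_iff.2 ⟨ubar, hubar, hwbar⟩,
    weaklyConverges_of_weakLim hxlim⟩, ⟨?_, ?_⟩,
    ⟨weaklyConverges_of_weakLim hylim, weaklyConverges_of_weakLim hzlim⟩, fun hcase => ?_⟩
  · rw [hfixset]
    exact ⟨ybar, ubar, hubar, hwbar, hxbar⟩
  · exact isLittleO_one_div_sqrt_of_sq_le (fun _ => norm_nonneg _) (fun _ => le_rfl) hrate
  · refine isLittleO_one_div_sqrt_of_sq_le (fun _ => norm_nonneg _) (fun k => ?_) hrate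
    have h1 := hc.norm_resolvent_sub_le hγ.le hA' (hu k) (hu (k + 1))
    rw [hx, hx] at h1
    gcongr
  obtain ⟨m, hm, hform⟩ := hc.exists_form_ge (H := H) hn (hstrict (hcase.imp And.left id))
  have hyos : γ • yosida γ (opF A) xbar = {xbar - ybar} := by
    have h1 : yosida γ (opF A) xbar = {(1 / γ) • (xbar - ybar)} := by
      ext v
      simp [yosida, hres]
    rw [h1, Set.smul_set_singleton, smul_smul, mul_one_div_cancel hγ.ne', one_smul]
  have hxu : xbar - ybar = γ • ubar := by rw [← hxbar, add_sub_cancel_left]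
  obtain ⟨C, -, hC⟩ := hc.exists_bound hγ hA' hu hx hxb
  have hulim := tendsto_of_form_ge (C := max (‖x 0 - p₀‖ + ‖p₀‖) C) hn hA' hm hform hu hw hx hyz hr
    (fun k => (hxb k).trans (le_max_left _ _)) (fun k => (hC k).trans (le_max_right _ _))
    hubar hwbar
  have hxy : Tendsto (fun k => x k - y k) atTop (𝓝 (xbar - ybar)) := by
    rw [hxu]
    refine (hulim.const_smul γ).congr fun k => ?_
    rw [← hx k, add_sub_cancel_left]
  refine ⟨hyos, hxy, ?_, ?_⟩
  · have h1 := hxy.add (hr.const_smul δ)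
    rw [smul_zero, add_zero] at h1
    refine h1.congr fun k => ?_
    rw [← hyz, sub_add_sub_cancel]
  · rw [hyos, hxu, hfixset, Set.singleton_add]
    ext p
    constructor
    · rintro ⟨y', hy', rfl⟩
      obtain ⟨u', hu', hw'⟩ := mem_zer_add_iff.1 hy'
      refine ⟨y', u', hu', hw', ?_⟩
      rw [eq_of_solutions hn hA' hm hform hubar hwbar hu' hw', add_comm]
    · rintro ⟨y', u', hu', hw', rfl⟩
      refine ⟨y', mem_zer_add_iff.2 ⟨u', hu', hw'⟩, ?_⟩
      dsimp only
      rw [eq_of_solutions hn hA' hm hform hubar hwbar hu' hw', add_comm]
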